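/- Let $A=[a_1,\dots,a_n]$ be a $d\times n$ integer matrix whose $d\times d$-minors are relatively prime, and let $\theta\in\mathbb{N}\mathcal{A}=\{\sum_i u_i a_i : u_i\in\mathbb{N}\}$ be generic, i.e. $\theta$ lies in no convex cone spanned by fewer than $d$ of the columns of $A$. Let $$P_\theta=\{u\in\mathbb{R}^n : Au=\theta,\ u\ge 0\}$$ (a simple polyhedron of dimension $n-d$), and let the bounded complex $P_\theta^{bd}$ be the polyhedral complex of all nonempty bounded faces of $P_\theta$. A polyhedral complex $K$ is called star-collapsible if there are cells $P_0,\dots,P_r$ of $K$ ($r\ge 0$) and vertices $p_j$ of $P_j$ such that, writing $P_{\le j}$ (resp. $P_{<j}$) for the complex of all nonempty faces of the $P_i$ with $i\le j$ (resp. $i<j$): $P_{\le r}=K$; for every $j$, $P_{\le j}\setminus P_{<j}$ consists precisely of the faces of $P_j$ which contain $p_j$; and $P_j\ne\{p_j\}$ for $j>0$. In that case $(P_j,p_j)_j$ is called a star-collapse of $K$. Theorem. The bounded complex $P_\theta^{bd}$ is star-collapsible. More precisely, let $v\in\mathbb{R}^n$ be such that $\langle v,x\rangle>0$ for all nonzero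 $x\ge 0$ with $Ax=0$, and such that $\langle v,\cdot\rangle$ is not constant on any face of $P_\theta$ of positive dimension. Let $p_0,\dots,p_r$ be the vertices of $P_\theta$, listed without repetition so that $\langle v,p_i\rangle<\langle v,p_j\rangle$ implies $i<j$. Then for each $j$ there is a largest bounded face $P_j$ of $P_\theta$ that contains $p_j$ and on which $\langle v,\cdot\rangle$ is maximal at $p_j$, and $(P_j,p_j)_j$ is a star-collapse of $P_\theta^{bd}$. In particular, the union of all bounded faces of $P_\theta$ is contractible. -/

import Mathlib

open scoped Matrix

namespace ToricHyper

section Complexes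

variable {E : Type*} [NormedAddCommGroup E] [NormedSpace ℝ E]

/-- `F` is a (nonempty) face of the convex set `P`: the set of maximizers over `P` of some linear
functional. The set `P` itself is a face of `P` (zero functional) if it is nonempty. -/
def IsFace (P F : Set E) : Prop :=
  F.Nonempty ∧ IsExposed ℝ P F

/-- The complex of all (nonempty) faces of `P`. -/
def faces (P : Set E) : Set (Set E) :=
  {F | IsFace P F}

/-- The bounded complex of a polyhedron `P`: all (nonempty) bounded faces of `P`. -/
def boundedComplex (P : Set E) : Set (Set E) :=
  {F | IsFace P F ∧ Bornology.IsBounded F}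

/-- The underlying space of a complex: the union of its cells. -/
def support (K : Set (Set E)) : Set E :=
  ⋃₀ K

/-- The complex `P_{≤ j}` of all faces of the cells `P 0, …, P j`. -/
def upTo {r : ℕ} (P : Fin (r + 1) → Set E) (j : Fin (r + 1)) : Set (Set E) :=
  {F | ∃ i, i ≤ j ∧ F ∈ faces (P i)}

/-- The complex `P_{< j}` of all faces of the cells `P i` with `i < j`. -/
def before {r : ℕ} (P : Fin (r + 1) → Set E) (j : Fin (r + 1)) : Set (Set E) :=
  {F | ∃ i, i < j ∧ F ∈ faces (P i)}

/-- The cells `P 0, …, P r` with the points `p 0, …, p r` form a star-collapse of the polyhedral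
complex `K`. -/
structure IsStarCollapse (K : Set (Set E)) {r : ℕ} (P : Fin (r + 1) → Set E)
    (p : Fin (r + 1) → E) : Prop where
  /-- every `P j` is a cell of `K` -/
  mem : ∀ j, P j ∈ K
  /-- `p j` is a vertex of `P j` -/
  vertex : ∀ j, IsFace (P j) {p j}
  /-- the cells `P j` and their faces make up the whole complex `K` -/
  exhaust : upTo P (Fin.last r) = K
  /-- `P_{≤ j} \ P_{< j}` consists precisely of the faces of `P j` that contain `p j` -/
  star : ∀ j, upTo P j \ before P j = {F | F ∈ faces (P j) ∧ p j ∈ F}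
  /-- every cell except the first has positive dimension; without this condition an isolated
  point could be added at any step, and `P_{< j}` would not be a retract of `P_{≤ j}` -/
  nontrivial : ∀ j, 0 < j → P j ≠ {p j}

/-- A polyhedral complex is star-collapsible if it has a star-collapse. -/
def IsStarCollapsible (K : Set (Set E)) : Prop :=
  ∃ (r : ℕ) (P : Fin (r + 1) → Set E) (p : Fin (r + 1) → E), IsStarCollapse K P p

end Complexes

section Polyhedra

variable {d n : ℕ}

/-- The integer matrix `A` has relatively prime maximal (`d × d`) minors. -/
def CoprimeMinors (A : Matrix (Fin d) (Fin n) ℤ) : Prop :=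
  Ideal.span (Set.range fun f : Fin d ↪o Fin n => (A.submatrix id f).det) = ⊤

/-- `θ` lies in the semigroup `ℕ𝒜` generated by the columns of `A`. -/
def InSemigroup (A : Matrix (Fin d) (Fin n) ℤ) (θ : Fin d → ℤ) : Prop :=
  ∃ u : Fin n → ℕ, A *ᵥ (fun i => (u i : ℤ)) = θ

/-- The convex cone in `ℝ^d` spanned by the columns of `A` with index in `S`. -/
def pos (A : Matrix (Fin d) (Fin n) ℤ) (S : Finset (Fin n)) : Set (Fin d → ℝ) :=
  {y | ∃ u : Fin n → ℝ, (∀ i, 0 ≤ u i) ∧ (∀ i, i ∉ S → u i = 0) ∧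
    A.map (Int.cast : ℤ → ℝ) *ᵥ u = y}

/-- `θ ∈ ℕ𝒜` is generic if it lies in none of the cones spanned by fewer than `d` columns
of `A`. -/
def IsGeneric (A : Matrix (Fin d) (Fin n) ℤ) (θ : Fin d → ℤ) : Prop :=
  InSemigroup A θ ∧ ∀ S : Finset (Fin n), S.card < d → (fun i => (θ i : ℝ)) ∉ pos A S

/-- The polyhedron `P_θ = {u ∈ ℝ^n : A u = θ, u ≥ 0}`. -/
def polyhedron (A : Matrix (Fin d) (Fin n) ℤ) (θ : Fin d → ℤ) : Set (Fin n → ℝ) :=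
  {u | A.map (Int.cast : ℤ → ℝ) *ᵥ u = (fun i => (θ i : ℝ)) ∧ ∀ i, 0 ≤ u i}

/-- The linear functional `u ↦ v ⬝ᵥ u` is positive on all nonzero recession directions of `P_θ`
(that is, `v` represents an interior point of the support of the normal fan), and it is not
constant on any face of positive dimension. -/
structure IsGenericFunctional (A : Matrix (Fin d) (Fin n) ℤ) (θ : Fin d → ℤ)
    (v : Fin n → ℝ) : Prop where
  interior : ∀ x : Fin n → ℝ, A.map (Int.cast : ℤ → ℝ) *ᵥ x = 0 → (∀ i, 0 ≤ x i) → x ≠ 0 →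
    0 < v ⬝ᵥ x
  nonconstant : ∀ F ∈ faces (polyhedron A θ), (∀ x ∈ F, ∀ y ∈ F, v ⬝ᵥ x = v ⬝ᵥ y) →
    F.Subsingleton

/-- `p 0, …, p r` lists the vertices of `P` without repetition, in an order that is compatible
with the values of the functional `u ↦ v ⬝ᵥ u`. -/
structure IsVertexOrder (P : Set (Fin n → ℝ)) (v : Fin n → ℝ) {r : ℕ}
    (p : Fin (r + 1) → Fin n → ℝ) : Prop where
  injective : Function.Injective p
  range_eq : Set.range p = {x | IsFace P {x}}
  order : ∀ i j, v ⬝ᵥ p i < v ⬝ᵥ p j → i < j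

end Polyhedra

end ToricHyper

/-!
The faces of `P_θ = {u | A u = θ, u ≥ 0}` are the nonempty sets `coordFace` obtained by requiring
some coordinates to vanish (`isFace_coordFace`, `IsFace.exists_eq_coordFace`), so all
face-theoretic questions become questions about supports of points.

*Star-collapse.* Genericity of `θ` makes the columns in the support of a vertex `p` a basis
(`exists_edge`): `P_θ` is simple, with one edge direction for each coordinate vanishing at `p`, and
these directions form a basis of the kernel of `A`. The face spanned by the edges along which `v`
decreases is the largest face on which `v` is maximal at `p`; it is bounded because `v` is positive
on recession directions (`exists_largest_boundedFace`). If there is no such edge, `v` attains its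
minimum over `P_θ` at `p`, so `p` comes first in the order. Every bounded face has a unique
`v`-maximal vertex `p_k`, and is then a face of `P_k`; a face of `P_j` that misses `p_j` has its
maximal vertex earlier in the order, which gives the star-collapse (`isStarCollapse_of_isGreatest`).
A generic `v` exists on the moment curve (`exists_pos_nonconstant_on_faces`).

*Contractibility.* A recession direction of a face is a nonnegative kernel vector whose support is
contained in that of the face, so a point of `P_θ` lies in a bounded face if and only if it is
minimal in `P_θ` for the coordinatewise order (`mem_support_boundedComplex_iff`). Sending `x` to the
point of least Euclidean norm in `{y ∈ P_θ | y ≤ x}` is a continuous retraction of the convex set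
`P_θ` onto these minimal points, and a retract of a contractible space is contractible
(`contractibleSpace_support_boundedComplex`).
-/

open Filter Topology

namespace ToricHyper

variable {d n : ℕ}

/-! ### Coordinate faces -/

/-- The part of the polyhedron `{u | M u = b, u ≥ 0}` on which the coordinates in `S` vanish. The
polyhedron itself is the case `S = ∅`, and its faces are exactly the nonempty sets of this form. -/
def coordFace (M : Matrix (Fin d) (Fin n) ℝ) (b : Fin d → ℝ) (S : Finset (Fin n)) :
    Set (Fin n → ℝ) :=
  {u | M *ᵥ u = b ∧ (∀ i, 0 ≤ u i) ∧ ∀ i ∈ S, u i = 0}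

/-- The functional `u ↦ v ⬝ᵥ u` as a continuous linear functional. -/
noncomputable def dotCLM (v : Fin n → ℝ) : StrongDual ℝ (Fin n → ℝ) :=
  ∑ i, v i • ContinuousLinearMap.proj i

@[simp]
lemma dotCLM_apply (v u : Fin n → ℝ) : dotCLM v u = v ⬝ᵥ u := by
  simp [dotCLM, dotProduct]

lemma isFace_argmax {C : Set (Fin n → ℝ)} (l : StrongDual ℝ (Fin n → ℝ)) {x : Fin n → ℝ}
    (hx : x ∈ C) (hmax : ∀ y ∈ C, l y ≤ l x) : IsFace C {y ∈ C | ∀ z ∈ C, l z ≤ l y} :=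
  ⟨⟨x, hx, hmax⟩, fun _ => ⟨l, rfl⟩⟩

variable {M : Matrix (Fin d) (Fin n) ℝ} {b : Fin d → ℝ} {S S₀ : Finset (Fin n)}
  {x y z : Fin n → ℝ}

lemma coordFace_anti (h : S₀ ⊆ S) : coordFace M b S ⊆ coordFace M b S₀ :=
  fun _ hu => ⟨hu.1, hu.2.1, fun i hi => hu.2.2 i (h hi)⟩

lemma convex_coordFace : Convex ℝ (coordFace M b S) := by
  intro x hx y hy s t hs ht hst
  refine ⟨?_, fun i => ?_, fun i hi => ?_⟩
  · rw [Matrix.mulVec_add, Matrix.mulVec_smul, Matrix.mulVec_smul, hx.1, hy.1, ← add_smul, hst,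
      one_smul]
  · have := hx.2.1 i
    have := hy.2.1 i
    simp only [Pi.add_apply, Pi.smul_apply, smul_eq_mul]
    positivity
  · simp [hx.2.2 i hi, hy.2.2 i hi]

lemma isClosed_coordFace : IsClosed (coordFace M b S) := by
  have h1 : IsClosed {u : Fin n → ℝ | M *ᵥ u = b} :=
    isClosed_eq (by fun_prop) continuous_const
  have h2 : IsClosed {u : Fin n → ℝ | ∀ i, 0 ≤ u i} := by
    simp only [Set.ofPred_forall]
    exact isClosed_iInter fun i => isClosed_le continuous_const (continuous_apply i)
  have h3 : IsClosed {u : Fin n → ℝ | ∀ i ∈ S, u i = 0} := by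
    simp only [Set.ofPred_forall]
    exact isClosed_iInter fun i => isClosed_iInter fun _ =>
      isClosed_eq (continuous_apply i) continuous_const
  exact h1.inter (h2.inter h3)

/-- A direction in the kernel of `M` that respects the constraints active at `x` is feasible. -/
lemma exists_pos_add_smul_mem (hx : x ∈ coordFace M b S) (hz : M *ᵥ z = 0)
    (hzS : ∀ i ∈ S, z i = 0) (h0 : ∀ i, x i = 0 → 0 ≤ z i) :
    ∃ ε : ℝ, 0 < ε ∧ x + ε • z ∈ coordFace M b S := by
  have key : ∀ᶠ ε : ℝ in 𝓝[>] 0, ∀ i, 0 ≤ x i + ε * z i := by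
    refine eventually_all.2 fun i => ?_
    rcases (hx.2.1 i).eq_or_lt with h | h
    · filter_upwards [self_mem_nhdsWithin] with ε hε
      rw [← h, zero_add]
      exact mul_nonneg (le_of_lt hε) (h0 i h.symm)
    · have : Tendsto (fun ε : ℝ => x i + ε * z i) (𝓝[>] 0) (𝓝 (x i)) := by
        have : Continuous fun ε : ℝ => x i + ε * z i := by fun_prop
        simpa using (this.tendsto 0).mono_left nhdsWithin_le_nhds
      filter_upwards [this.eventually (lt_mem_nhds h)] with ε hε using hε.le
  obtain ⟨ε, hε, hpos⟩ := (key.and self_mem_nhdsWithin).exists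
  refine ⟨ε, hpos, ?_, fun i => by simpa using hε i, fun i hi => ?_⟩
  · rw [Matrix.mulVec_add, Matrix.mulVec_smul, hz, hx.1, smul_zero, add_zero]
  · simp [hx.2.2 i hi, hzS i hi]

lemma isFace_coordFace (hS : S₀ ⊆ S) (hne : (coordFace M b S).Nonempty) :
    IsFace (coordFace M b S₀) (coordFace M b S) := by
  obtain ⟨w, hw⟩ := hne
  refine ⟨⟨w, hw⟩, fun _ => ⟨-∑ i ∈ S, ContinuousLinearMap.proj i, ?_⟩⟩
  ext x
  simp only [neg_apply, sum_apply,
    ContinuousLinearMap.proj_apply, neg_le_neg_iff, Set.mem_ofPred_eq]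
  refine ⟨fun hx => ⟨coordFace_anti hS hx, fun y hy => ?_⟩, fun hx => ⟨hx.1.1, hx.1.2.1, ?_⟩⟩
  · rw [Finset.sum_eq_zero hx.2.2]
    exact Finset.sum_nonneg fun i _ => hy.2.1 i
  · have h := hx.2 w (coordFace_anti hS hw)
    rw [Finset.sum_eq_zero hw.2.2] at h
    exact (Finset.sum_eq_zero_iff_of_nonneg fun i _ => hx.1.2.1 i).1
      (h.antisymm (Finset.sum_nonneg fun i _ => hx.1.2.1 i))

lemma IsFace.exists_eq_coordFace {F : Set (Fin n → ℝ)} (hF : IsFace (coordFace M b S₀) F) :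
    ∃ S, S₀ ⊆ S ∧ F = coordFace M b S := by
  classical
  obtain ⟨hne, hexp⟩ := hF
  obtain ⟨l, hl⟩ := hexp hne
  have hsub : F ⊆ coordFace M b S₀ := fun x hx => by rw [hl] at hx; exact hx.1
  have hconv : Convex ℝ F := hexp.convex convex_coordFace
  -- a point of `F` with the fewest zero coordinates lies in the relative interior of `F`
  obtain ⟨x, hxF, hx⟩ : ∃ x ∈ F, ∀ y ∈ F,
      (Finset.univ.filter fun i => x i = 0).card ≤ (Finset.univ.filter fun i => y i = 0).card := by
    obtain ⟨x, hx, hmin⟩ := WellFounded.has_min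
      (measure fun x : Fin n → ℝ => (Finset.univ.filter fun i => x i = 0).card).wf F hne
    exact ⟨x, hx, fun y hy => not_lt.1 (hmin y hy)⟩
  have hzero : ∀ y ∈ F, ∀ i, x i = 0 → y i = 0 := by
    intro y hy i hi
    have hm : (1 / 2 : ℝ) • x + (1 / 2 : ℝ) • y ∈ F :=
      hconv hxF hy (by norm_num) (by norm_num) (by norm_num)
    have hiff : ∀ k, ((1 / 2 : ℝ) • x + (1 / 2 : ℝ) • y) k = 0 ↔ x k = 0 ∧ y k = 0 := by
      intro k
      have h1 := (hsub hxF).2.1 k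
      have h2 := (hsub hy).2.1 k
      simp only [Pi.add_apply, Pi.smul_apply, smul_eq_mul]
      constructor
      · intro h
        constructor <;> linarith
      · rintro ⟨h, h'⟩
        rw [h, h']
        simp
    have hss : (Finset.univ.filter fun k => ((1 / 2 : ℝ) • x + (1 / 2 : ℝ) • y) k = 0) ⊆
        Finset.univ.filter fun k => x k = 0 := by
      intro k hk
      simp only [Finset.mem_filter, Finset.mem_univ, true_and, hiff] at hk ⊢
      exact hk.1
    have heq := Finset.eq_of_subset_of_card_le hss (hx _ hm)
    have : i ∈ Finset.univ.filter fun k => ((1 / 2 : ℝ) • x + (1 / 2 : ℝ) • y) k = 0 := by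
      rw [heq]
      simpa using hi
    simp only [Finset.mem_filter, Finset.mem_univ, true_and, hiff] at this
    exact this.2
  refine ⟨Finset.univ.filter fun i => x i = 0, fun i hi => ?_, Set.Subset.antisymm ?_ ?_⟩
  · simpa using (hsub hxF).2.2 i hi
  · exact fun y hy => ⟨(hsub hy).1, (hsub hy).2.1, fun i hi => hzero y hy i (by simpa using hi)⟩
  · intro u hu
    have hu0 : ∀ i, x i = 0 → u i = 0 := fun i hi => hu.2.2 i (by simpa using hi)
    have huS : u ∈ coordFace M b S₀ :=
      ⟨hu.1, hu.2.1, fun i hi => hu0 i ((hsub hxF).2.2 i hi)⟩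
    -- `x` can be moved beyond itself, away from `u`, so `l` cannot be smaller at `u` than at `x`
    obtain ⟨ε, hε, hmem⟩ := exists_pos_add_smul_mem (z := x - u) (hsub hxF)
      (by rw [Matrix.mulVec_sub, (hsub hxF).1, hu.1, sub_self])
      (fun i hi => by simp [(hsub hxF).2.2 i hi, huS.2.2 i hi])
      (fun i hi => by simp [hi, hu0 i hi])
    rw [hl] at hxF ⊢
    have h := hxF.2 _ hmem
    simp only [map_add, map_smul, map_sub, smul_eq_mul] at h
    have : l x ≤ l u := by
      by_contra! hlt
      have := mul_pos hε (sub_pos.2 hlt)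
      linarith
    exact ⟨huS, fun y hy => (hxF.2 y hy).trans this⟩

lemma IsFace.trans_coordFace {F G : Set (Fin n → ℝ)} (hF : IsFace (coordFace M b S₀) F)
    (hG : IsFace F G) : IsFace (coordFace M b S₀) G := by
  obtain ⟨S, hS, rfl⟩ := hF.exists_eq_coordFace
  obtain ⟨T, hT, rfl⟩ := hG.exists_eq_coordFace
  exact isFace_coordFace (hS.trans hT) hG.1

lemma IsFace.of_subset {P F G : Set (Fin n → ℝ)} (hG : IsFace P G) (hF : IsFace P F)
    (h : G ⊆ F) : IsFace F G :=
  ⟨hG.1, hG.2.mono hF.2.subset h⟩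

lemma finite_faces_coordFace : (faces (coordFace M b S₀)).Finite := by
  refine (Set.finite_range (coordFace M b)).subset fun F hF => ?_
  obtain ⟨S, -, rfl⟩ := IsFace.exists_eq_coordFace hF
  exact ⟨S, rfl⟩

/-- A coordinate face without nonzero recession directions is bounded, because `M` is bounded away
from zero on the points of the standard simplex that vanish on `S`. -/
lemma isBounded_coordFace
    (h : ∀ z : Fin n → ℝ, M *ᵥ z = 0 → (∀ i, 0 ≤ z i) → (∀ i ∈ S, z i = 0) → z = 0) :
    Bornology.IsBounded (coordFace M b S) := by
  set K : Set (Fin n → ℝ) := stdSimplex ℝ (Fin n) ∩ {z | ∀ i ∈ S, z i = 0} with hK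
  have hKc : IsCompact K := by
    refine (isCompact_stdSimplex ℝ (Fin n)).inter_right ?_
    simp only [Set.ofPred_forall]
    exact isClosed_iInter fun i => isClosed_iInter fun _ =>
      isClosed_eq (continuous_apply i) continuous_const
  obtain ⟨c, hc, hcK⟩ : ∃ c : ℝ, 0 < c ∧ ∀ z ∈ K, c ≤ ‖M *ᵥ z‖ := by
    rcases K.eq_empty_or_nonempty with hemp | hne
    · exact ⟨1, one_pos, by simp [hemp]⟩
    · obtain ⟨w, hw, hmin⟩ := hKc.exists_isMinOn hne
        (f := fun z => ‖M *ᵥ z‖) (Continuous.continuousOn (by fun_prop))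
      refine ⟨‖M *ᵥ w‖, norm_pos_iff.2 fun h0 => ?_, hmin⟩
      have := h w h0 hw.1.1 hw.2
      have h1 := hw.1.2
      simp [this] at h1
  refine (Metric.isBounded_closedBall (x := (0 : Fin n → ℝ)) (r := ‖b‖ / c)).subset fun u hu => ?_
  have hs : ∑ i, u i ≤ ‖b‖ / c := by
    rcases (Finset.sum_nonneg fun i (_ : i ∈ Finset.univ) => hu.2.1 i).eq_or_lt with h0 | h0
    · rw [← h0]
      positivity
    · have hmem : (∑ i, u i)⁻¹ • u ∈ K := by
        refine ⟨⟨fun i => ?_, ?_⟩, fun i hi => by simp [hu.2.2 i hi]⟩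
        · simpa using mul_nonneg (inv_nonneg.2 h0.le) (hu.2.1 i)
        · simp only [Pi.smul_apply, smul_eq_mul, ← Finset.mul_sum]
          exact inv_mul_cancel₀ h0.ne'
      have := hcK _ hmem
      rw [Matrix.mulVec_smul, hu.1, norm_smul, norm_inv, Real.norm_of_nonneg h0.le] at this
      rw [le_div_iff₀ hc]
      rw [inv_mul_eq_div, le_div_iff₀ h0] at this
      linarith
  rw [mem_closedBall_zero_iff]
  refine (pi_norm_le_iff_of_nonneg (by positivity)).2 fun i => ?_
  rw [Real.norm_of_nonneg (hu.2.1 i)]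
  exact (Finset.single_le_sum (fun i _ => hu.2.1 i) (Finset.mem_univ i)).trans hs

/-! ### Bounded faces and coordinatewise minimal points -/

/-- The support of the bounded complex consists of the points of the polyhedron that are minimal
for the coordinatewise order: up to positive scaling, the nonzero recession directions of the
smallest face containing `x` are the differences `x - y` with `y` in the polyhedron and `y < x`. -/
lemma mem_support_boundedComplex_iff :
    x ∈ support (boundedComplex (coordFace M b S₀)) ↔ Minimal (· ∈ coordFace M b S₀) x := by
  constructor
  · rintro ⟨F, ⟨hF, hbd⟩, hx⟩
    have hsub : F ⊆ coordFace M b S₀ := hF.2.subset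
    refine ⟨hsub hx, fun y hy hyx => ?_⟩
    obtain ⟨S, hS, rfl⟩ := hF.exists_eq_coordFace
    -- the whole ray from `x` in direction `x - y` lies in the bounded face
    have hray : ∀ t : ℝ, 0 ≤ t → x + t • (x - y) ∈ coordFace M b S := by
      intro t ht
      refine ⟨?_, fun i => ?_, fun i hi => ?_⟩
      · rw [Matrix.mulVec_add, Matrix.mulVec_smul, Matrix.mulVec_sub, hx.1, hy.1]
        simp
      · have h1 := hx.2.1 i
        have h2 := mul_nonneg ht (sub_nonneg.2 (hyx i))
        simpa using add_nonneg h1 h2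
      · have h1 := hx.2.2 i hi
        have h2 : y i = 0 := le_antisymm (h1 ▸ hyx i) (hy.2.1 i)
        simp [h1, h2]
    obtain ⟨C, hC⟩ := hbd.exists_norm_le
    intro i
    by_contra! hlt
    have hpos : 0 < x i - y i := sub_pos.2 hlt
    have hCn : 0 ≤ C := (norm_nonneg _).trans (hC _ hx)
    have := (norm_le_pi_norm _ i).trans (hC _ (hray ((C + 1) / (x i - y i)) (by positivity)))
    simp only [Pi.add_apply, Pi.smul_apply, Pi.sub_apply, smul_eq_mul] at this
    rw [div_mul_cancel₀ _ hpos.ne', Real.norm_eq_abs] at this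
    have h1 := hx.2.1 i
    have := (le_abs_self _).trans this
    linarith
  · intro hx
    classical
    have hmem : x ∈ coordFace M b (Finset.univ.filter fun i => x i = 0) :=
      ⟨hx.1.1, hx.1.2.1, by simp⟩
    refine ⟨_, ⟨isFace_coordFace (S := Finset.univ.filter fun i => x i = 0) (fun i hi => ?_)
      ⟨x, hmem⟩, isBounded_coordFace fun z hz hz0 hzx => ?_⟩, hmem⟩
    · simpa using hx.1.2.2 i hi
    · have hzx' : ∀ i, x i = 0 → z i = 0 := fun i hi => hzx i (by simpa using hi)
      obtain ⟨ε, hε, h⟩ := exists_pos_add_smul_mem (z := -z) hx.1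
        (by rw [Matrix.mulVec_neg, hz, neg_zero]) (fun i hi => by simp [hzx' i (hx.1.2.2 i hi)])
        (fun i hi => by simp [hzx' i hi])
      have hle := hx.2 h fun i => by
        have := mul_nonneg hε.le (hz0 i)
        simpa using this
      ext i
      have h1 := hle i
      have h2 := hz0 i
      simp only [Pi.add_apply, Pi.smul_apply, Pi.neg_apply, smul_eq_mul] at h1
      have : ε * z i ≤ 0 := by linarith
      exact le_antisymm (nonpos_of_mul_nonpos_right this hε) h2

/-- The point of least Euclidean norm among the points of a coordinate face below `x`. -/
lemma exists_least_dotProduct_self (hx : x ∈ coordFace M b S) :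
    ∃ y ∈ coordFace M b S, y ≤ x ∧ ∀ z ∈ coordFace M b S, z ≤ x → y ⬝ᵥ y ≤ z ⬝ᵥ z := by
  have hc : IsCompact (coordFace M b S ∩ Set.Icc 0 x) :=
    isCompact_Icc.inter_left isClosed_coordFace
  obtain ⟨y, hy, hmin⟩ := hc.exists_isMinOn ⟨x, hx, hx.2.1, le_rfl⟩
    (f := fun y => y ⬝ᵥ y) (Continuous.continuousOn (by fun_prop))
  exact ⟨y, hy.1, hy.2.2, fun z hz hzx => hmin ⟨hz, hz.2.1, hzx⟩⟩

/-- The point of least norm below `x` is unique, by strict convexity of the squared norm. -/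
lemma eq_of_least_dotProduct_self (hy : y ∈ coordFace M b S) (hyx : y ≤ x)
    (hmin : ∀ z ∈ coordFace M b S, z ≤ x → y ⬝ᵥ y ≤ z ⬝ᵥ z)
    (hz : z ∈ coordFace M b S) (hzx : z ≤ x) (hzy : z ⬝ᵥ z ≤ y ⬝ᵥ y) : z = y := by
  have hmid : (1 / 2 : ℝ) • y + (1 / 2 : ℝ) • z ∈ coordFace M b S :=
    convex_coordFace hy hz (by norm_num) (by norm_num) (by norm_num)
  have hm := hmin _ hmid (fun i => by
      have h1 := hyx i
      have h2 := hzx i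
      simp only [Pi.add_apply, Pi.smul_apply, smul_eq_mul]
      linarith)
  have h0 : (z - y) ⬝ᵥ (z - y) ≤ 0 := by
    simp only [dotProduct_add, add_dotProduct, smul_dotProduct, dotProduct_smul, smul_eq_mul,
      sub_dotProduct, dotProduct_sub, dotProduct_comm z y] at hm ⊢
    linarith
  have h1 : 0 ≤ (z - y) ⬝ᵥ (z - y) := Finset.sum_nonneg fun i _ => mul_self_nonneg _
  exact sub_eq_zero.1 (dotProduct_self_eq_zero.1 (h0.antisymm h1))

/-- The point of least norm below `x` depends continuously on `x`. -/
lemma continuous_of_least_dotProduct_self {r : coordFace M b S → Fin n → ℝ}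
    (hr : ∀ x, r x ∈ coordFace M b S) (hrx : ∀ x, r x ≤ x)
    (hmin : ∀ x : coordFace M b S, ∀ z ∈ coordFace M b S, z ≤ x → r x ⬝ᵥ r x ≤ z ⬝ᵥ z) :
    Continuous r := by
  refine continuous_iff_continuousAt.2 fun x => (tendsto_iff_ultrafilter _ _ _).2 fun g hg => ?_
  have hid : Tendsto (fun x' : coordFace M b S => (x' : Fin n → ℝ)) g (𝓝 x) :=
    (continuous_subtype_val.tendsto x).mono_left hg
  have hcoord : ∀ i, Tendsto (fun x' : coordFace M b S => (x' : Fin n → ℝ) i) g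
      (𝓝 ((x : Fin n → ℝ) i)) := tendsto_pi_nhds.1 hid
  have hcpt : (g.map r : Filter _) ≤ 𝓟 (Set.Icc 0 ((x : Fin n → ℝ) + 1)) := by
    rw [le_principal_iff]
    have : ∀ᶠ x' : coordFace M b S in g, ∀ i,
        (x' : Fin n → ℝ) i < (x : Fin n → ℝ) i + 1 :=
      eventually_all.2 fun i => (hcoord i).eventually (gt_mem_nhds (lt_add_one _))
    change ∀ᶠ x' in g, r x' ∈ Set.Icc 0 ((x : Fin n → ℝ) + 1)
    filter_upwards [this] with x' hx'
    exact ⟨(hr x').2.1, fun i => (hrx x' i).trans (hx' i).le⟩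
  obtain ⟨y, -, hy⟩ := isCompact_Icc.ultrafilter_le_nhds (g.map r) hcpt
  replace hy : Tendsto r g (𝓝 y) := hy
  have hyP : y ∈ coordFace M b S := isClosed_coordFace.mem_of_tendsto hy (.of_forall hr)
  have hyx : y ≤ x := le_of_tendsto_of_tendsto hy hid (.of_forall hrx)
  -- moving from a nearby `x'` by slightly less than `x - r x` stays feasible
  set w : Fin n → ℝ := x - r x with hw
  have hw0 : ∀ i, 0 ≤ w i := fun i => sub_nonneg.2 (hrx x i)
  have hlt : ∀ t ∈ Set.Ico (0 : ℝ) 1,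
      y ⬝ᵥ y ≤ ((x : Fin n → ℝ) - t • w) ⬝ᵥ ((x : Fin n → ℝ) - t • w) := by
    intro t ht
    have hev : ∀ᶠ x' : coordFace M b S in g, ∀ i, 0 ≤ (x' : Fin n → ℝ) i - t * w i := by
      refine eventually_all.2 fun i => ?_
      rcases (hw0 i).eq_or_lt with h | h
      · exact .of_forall fun x' => by simpa [← h] using x'.2.2.1 i
      · have h1 : t * w i < (x : Fin n → ℝ) i := by
          have h2 : w i ≤ (x : Fin n → ℝ) i := by
            simpa [hw] using (hr x).2.1 i
          nlinarith [ht.2]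
        filter_upwards [(hcoord i).eventually (lt_mem_nhds h1)] with x' hx'
        exact sub_nonneg.2 hx'.le
    have hd : Continuous fun u : Fin n → ℝ => u ⬝ᵥ u := by fun_prop
    have hd' : Continuous fun u : Fin n → ℝ => (u - t • w) ⬝ᵥ (u - t • w) := by fun_prop
    refine le_of_tendsto_of_tendsto ((hd.tendsto y).comp hy) ((hd'.tendsto _).comp hid) ?_
    filter_upwards [hev] with x' hx'
    refine hmin x' _ ⟨?_, fun i => by simpa using hx' i, fun i hi => ?_⟩ fun i => ?_
    · rw [Matrix.mulVec_sub, Matrix.mulVec_smul, hw, Matrix.mulVec_sub, x.2.1, (hr x).1, x'.2.1]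
      simp
    · simp [hw, x'.2.2.2 i hi, x.2.2.2 i hi, (hr x).2.2 i hi]
    · simpa using mul_nonneg ht.1 (hw0 i)
  have hle : y ⬝ᵥ y ≤ r x ⬝ᵥ r x := by
    have hd : Continuous fun t : ℝ =>
        ((x : Fin n → ℝ) - t • w) ⬝ᵥ ((x : Fin n → ℝ) - t • w) := by fun_prop
    have h1 := (hd.tendsto 1).mono_left (nhdsWithin_le_nhds (s := Set.Iio 1))
    have h2 : (x : Fin n → ℝ) - (1 : ℝ) • w = r x := by simp [hw]
    rw [h2] at h1
    refine ge_of_tendsto h1 ?_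
    filter_upwards [Ico_mem_nhdsLT (zero_lt_one (α := ℝ))] with t ht using hlt t ht
  rwa [← eq_of_least_dotProduct_self (hr x) (hrx x) (hmin x) hyP hyx hle]

lemma contractibleSpace_of_leftInverse {X Y : Type*} [TopologicalSpace X] [TopologicalSpace Y]
    [ContractibleSpace X] (i : C(Y, X)) (r : C(X, Y)) (h : Function.LeftInverse r i) :
    ContractibleSpace Y := by
  rw [contractible_iff_id_nullhomotopic]
  have hc := ((id_nullhomotopic X).comp_left i).comp_right r
  convert hc using 1
  ext y
  simp [h y]

/-- The map sending `x` to the point of least norm below `x` retracts the convex set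
`coordFace M b S` onto the union of its bounded faces. -/
lemma contractibleSpace_support_boundedComplex (hne : (coordFace M b S).Nonempty) :
    ContractibleSpace (support (boundedComplex (coordFace M b S))) := by
  choose r hr hrx hmin using fun x : coordFace M b S => exists_least_dotProduct_self x.2
  have hcont := continuous_of_least_dotProduct_self hr hrx hmin
  have hrm : ∀ x, r x ∈ support (boundedComplex (coordFace M b S)) := by
    intro x
    refine mem_support_boundedComplex_iff.2 ⟨hr x, fun y hy hyr => ?_⟩
    -- the squared norm is monotone on the nonnegative orthant
    have hle : y ⬝ᵥ y ≤ r x ⬝ᵥ r x :=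
      Finset.sum_le_sum fun i _ => mul_le_mul (hyr i) (hyr i) (hy.2.1 i) ((hr x).2.1 i)
    exact (eq_of_least_dotProduct_self (hr x) (hrx x) (hmin x) hy (hyr.trans (hrx x)) hle).ge
  have : ContractibleSpace (coordFace M b S) := convex_coordFace.contractibleSpace hne
  have hmem : ∀ x ∈ support (boundedComplex (coordFace M b S)), x ∈ coordFace M b S :=
    fun x hx => (mem_support_boundedComplex_iff.1 hx).1
  refine contractibleSpace_of_leftInverse
    ⟨fun x => ⟨x.1, hmem x.1 x.2⟩, by fun_prop⟩
    ⟨fun x => ⟨r x, hrm x⟩, by fun_prop⟩ fun x => Subtype.ext ?_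
  have hx := mem_support_boundedComplex_iff.1 x.2
  exact le_antisymm (hrx _) (hx.2 (hr _) (hrx _))

variable {p v : Fin n → ℝ}

/-! ### Edges at a vertex of a simple polyhedron -/

/-- The columns of `M` in the support of a vertex are linearly independent. -/
lemma IsFace.eq_zero_of_vertex (hp : IsFace (coordFace M b S₀) {p}) {z : Fin n → ℝ}
    (hz : M *ᵥ z = 0) (hzp : ∀ k, p k = 0 → z k = 0) : z = 0 := by
  obtain ⟨S, -, hS⟩ := hp.exists_eq_coordFace
  have hpS : p ∈ coordFace M b S := hS ▸ Set.mem_singleton p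
  obtain ⟨ε, hε, h⟩ := exists_pos_add_smul_mem hpS hz (fun i hi => hzp i (hpS.2.2 i hi))
    (fun i hi => (hzp i hi).ge)
  rw [← hS, Set.mem_singleton_iff, add_eq_left] at h
  exact (smul_eq_zero.1 h).resolve_left hε.ne'

/-- If `b` is generic, the columns of `M` in the support of a vertex `p` form a basis. Hence each
coordinate `i` that vanishes at `p` has an edge direction: a kernel vector with `i`-th coordinate
`1` whose other coordinates outside the support of `p` are zero. -/
lemma exists_edge (hgen : ∀ S : Finset (Fin n), S.card < d → ∀ u ∈ coordFace M b ∅,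
      ∃ i, i ∉ S ∧ u i ≠ 0)
    (hp : IsFace (coordFace M b ∅) {p}) (i : Fin n) (hi : p i = 0) :
    ∃ e : Fin n → ℝ, M *ᵥ e = 0 ∧ e i = 1 ∧ ∀ k, p k = 0 → k ≠ i → e k = 0 := by
  classical
  have hpP : p ∈ coordFace M b ∅ := hp.2.subset rfl
  let ext : ({k // p k ≠ 0} → ℝ) →ₗ[ℝ] Fin n → ℝ := Function.ExtendByZero.linearMap ℝ Subtype.val
  have hext : ∀ y (k : {k // p k ≠ 0}), ext y k = y k := fun y k =>
    Subtype.val_injective.extend_apply _ _ _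
  have hext0 : ∀ y k, p k = 0 → ext y k = 0 := fun y k hk =>
    Function.extend_apply' _ _ _ (by rintro ⟨⟨j, hj⟩, rfl⟩; exact hj hk)
  let f : ({k // p k ≠ 0} → ℝ) →ₗ[ℝ] Fin d → ℝ := M.mulVecLin ∘ₗ ext
  have hinj : Function.Injective f := by
    refine (injective_iff_map_eq_zero f).2 fun y hy => ?_
    have h0 : ext y = 0 := hp.eq_zero_of_vertex hy (hext0 y)
    ext k
    rw [← hext y k, h0]
    rfl
  have hcard : Fintype.card {k // p k ≠ 0} = d := by
    refine le_antisymm (by simpa using LinearMap.finrank_le_finrank_of_injective hinj) ?_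
    by_contra! hlt
    rw [Fintype.card_subtype] at hlt
    obtain ⟨k, hk, hk0⟩ := hgen _ hlt p hpP
    simp [hk0] at hk
  have hsurj : Function.Surjective f :=
    (LinearMap.injective_iff_surjective_of_finrank_eq_finrank (by simpa using hcard)).1 hinj
  obtain ⟨y, hy⟩ := hsurj (M *ᵥ Pi.single i 1)
  refine ⟨Pi.single i 1 - ext y, ?_, ?_, fun k hk hki => ?_⟩
  · rw [Matrix.mulVec_sub, ← hy]
    exact sub_self _
  · simp [hext0 y i hi]
  · simp [hext0 y k hk, hki]

/-- At each vertex `p` of a simple polyhedron there is a largest bounded face on which `v` is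
maximal at `p`: the face spanned by the edges at `p` along which `v` decreases. If there are no
such edges, then `v` is minimal at `p`. -/
lemma exists_largest_boundedFace
    (hgen : ∀ S : Finset (Fin n), S.card < d → ∀ u ∈ coordFace M b ∅, ∃ i, i ∉ S ∧ u i ≠ 0)
    (hint : ∀ x : Fin n → ℝ, M *ᵥ x = 0 → (∀ i, 0 ≤ x i) → x ≠ 0 → 0 < v ⬝ᵥ x)
    (hnc : ∀ F ∈ faces (coordFace M b ∅), (∀ x ∈ F, ∀ y ∈ F, v ⬝ᵥ x = v ⬝ᵥ y) →
      F.Subsingleton)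
    (hp : IsFace (coordFace M b ∅) {p}) :
    ∃ Q, IsGreatest {F | F ∈ boundedComplex (coordFace M b ∅) ∧ p ∈ F ∧
        ∀ x ∈ F, v ⬝ᵥ x ≤ v ⬝ᵥ p} Q ∧
      (Q = {p} → ∀ u ∈ coordFace M b ∅, v ⬝ᵥ p ≤ v ⬝ᵥ u) := by
  classical
  have hpP : p ∈ coordFace M b ∅ := hp.2.subset rfl
  choose e heM hei hek using exists_edge hgen hp
  let E : Fin n → Fin n → ℝ := fun i => if h : p i = 0 then e i h else 0
  have hEM : ∀ i, M *ᵥ E i = 0 := fun i => by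
    by_cases h : p i = 0
    · simp [E, h, heM]
    · simp [E, h]
  have hEi : ∀ i, p i = 0 → E i i = 1 := fun i h => by simp [E, h, hei]
  have hEk : ∀ i k, p k = 0 → k ≠ i → E i k = 0 := fun i k hk hki => by
    by_cases h : p i = 0
    · simp [E, h, hek i h k hk hki]
    · simp [E, h]
  have hE0 : ∀ i, p i ≠ 0 → E i = 0 := fun i h => by simp [E, h]
  -- the edge directions at `p` form a basis of the kernel of `M`
  have hker : ∀ z : Fin n → ℝ, M *ᵥ z = 0 → z = ∑ i, z i • E i := by
    intro z hz
    rw [← sub_eq_zero]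
    refine hp.eq_zero_of_vertex ?_ fun k hk => ?_
    · rw [Matrix.mulVec_sub, hz, Matrix.mulVec_sum]
      simp [Matrix.mulVec_smul, hEM]
    · rw [Pi.sub_apply, Finset.sum_apply, Finset.sum_eq_single k]
      · simp [hEi k hk]
      · intro i _ hik
        simp [hEk i k hk hik.symm]
      · simp
  have hv : ∀ z : Fin n → ℝ, M *ᵥ z = 0 → v ⬝ᵥ z = ∑ i, z i * (v ⬝ᵥ E i) := by
    intro z hz
    conv_lhs => rw [hker z hz]
    simp [dotProduct_sum, dotProduct_smul]
  -- a positive multiple of each edge direction can be added to `p` within the polyhedron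
  have hmove : ∀ i, p i = 0 → ∃ ε : ℝ, 0 < ε ∧ p + ε • E i ∈ coordFace M b ∅ := by
    intro i hi
    refine exists_pos_add_smul_mem hpP (hEM i) (by simp) fun k hk => ?_
    by_cases hki : k = i
    · subst hki
      simp [hEi k hk]
    · simp [hEk i k hk hki]
  set T : Finset (Fin n) := Finset.univ.filter fun i => p i = 0 ∧ 0 ≤ v ⬝ᵥ E i with hT
  have hpT : p ∈ coordFace M b T :=
    ⟨hpP.1, hpP.2.1, fun i hi => by simp only [hT, Finset.mem_filter] at hi; exact hi.2.1⟩
  have hvE : ∀ i, i ∉ T → v ⬝ᵥ E i ≤ 0 := by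
    intro i hi
    by_cases h : p i = 0
    · by_contra! hpos
      exact hi (by simp [hT, h, hpos.le])
    · simp [hE0 i h]
  have hle : ∀ z : Fin n → ℝ, M *ᵥ z = 0 → (∀ i, p i = 0 → 0 ≤ z i) → (∀ i ∈ T, z i = 0) →
      v ⬝ᵥ z ≤ 0 := by
    intro z hz h0 hzT
    rw [hv z hz]
    refine Finset.sum_nonpos fun i _ => ?_
    by_cases hi : i ∈ T
    · simp [hzT i hi]
    · by_cases h : p i = 0
      · exact mul_nonpos_of_nonneg_of_nonpos (h0 i h) (hvE i hi)
      · simp [hE0 i h]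
  refine ⟨coordFace M b T, ⟨⟨⟨isFace_coordFace (Finset.empty_subset _) ⟨p, hpT⟩,
    isBounded_coordFace fun z hz hz0 hzT => ?_⟩, hpT, fun x hx => ?_⟩, ?_⟩, fun hTp u hu => ?_⟩
  · by_contra hne
    exact (hint z hz hz0 hne).not_ge (hle z hz (fun i _ => hz0 i) hzT)
  · have := hle (x - p) (by rw [Matrix.mulVec_sub, hx.1, hpT.1, sub_self])
      (fun i hi => by simpa [hi] using hx.2.1 i) (fun i hi => by simp [hx.2.2 i hi, hpT.2.2 i hi])
    rw [dotProduct_sub] at this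
    linarith
  · rintro F ⟨⟨hF, -⟩, hpF, hFv⟩
    obtain ⟨S, -, rfl⟩ := hF.exists_eq_coordFace
    intro u hu
    refine ⟨hu.1, hu.2.1, fun i hi => ?_⟩
    by_cases hiS : i ∈ S
    · exact hu.2.2 i hiS
    · -- otherwise the edge in direction `E i` lies in `F`, and `v` does not decrease along it
      exfalso
      obtain ⟨hpi, hvi⟩ : p i = 0 ∧ 0 ≤ v ⬝ᵥ E i := by simpa [hT] using hi
      obtain ⟨ε, hε, hmem⟩ := hmove i hpi
      have hmemS : p + ε • E i ∈ coordFace M b S := by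
        refine ⟨hmem.1, hmem.2.1, fun k hk => ?_⟩
        have hki : k ≠ i := fun h => hiS (h ▸ hk)
        simp [hpF.2.2 k hk, hEk i k (hpF.2.2 k hk) hki]
      have hv0 : v ⬝ᵥ E i = 0 := by
        have := hFv _ hmemS
        rw [dotProduct_add, dotProduct_smul, smul_eq_mul] at this
        have : ε * (v ⬝ᵥ E i) ≤ 0 := by linarith
        exact le_antisymm (nonpos_of_mul_nonpos_right this hε) hvi
      set R : Finset (Fin n) := Finset.univ.filter fun k => p k = 0 ∧ k ≠ i with hR
      have hpR : p ∈ coordFace M b R :=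
        ⟨hpP.1, hpP.2.1, fun k hk => by simp only [hR, Finset.mem_filter] at hk; exact hk.2.1⟩
      have hqR : p + ε • E i ∈ coordFace M b R := by
        refine ⟨hmem.1, hmem.2.1, fun k hk => ?_⟩
        simp only [hR, Finset.mem_filter] at hk
        simp [hk.2.1, hEk i k hk.2.1 hk.2.2]
      -- on the whole edge `v` takes the value `v ⬝ᵥ p`
      have hconst : ∀ x ∈ coordFace M b R, v ⬝ᵥ x = v ⬝ᵥ p := by
        intro x hx
        have h := hv (x - p) (by rw [Matrix.mulVec_sub, hx.1, hpP.1, sub_self])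
        rw [Finset.sum_eq_zero, dotProduct_sub] at h
        · linarith
        · intro k _
          by_cases hk : p k = 0
          · by_cases hki : k = i
            · rw [hki, hv0, mul_zero]
            · simp [hx.2.2 k (by simp [hR, hk, hki]), hk]
          · simp [hE0 k hk]
      have heq := hnc _ (isFace_coordFace (Finset.empty_subset _) ⟨p, hpR⟩)
        (fun x hx y hy => (hconst x hx).trans (hconst y hy).symm) hpR hqR
      have := congrFun heq i
      simp only [Pi.add_apply, Pi.smul_apply, hEi i hpi, smul_eq_mul, mul_one] at this
      linarith
  · have hpos : ∀ i, 0 ≤ v ⬝ᵥ E i := by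
      intro i
      by_contra! hneg
      have hpi : p i = 0 := by
        by_contra h
        simp [hE0 i h] at hneg
      obtain ⟨ε, hε, hmem⟩ := hmove i hpi
      have hmemT : p + ε • E i ∈ coordFace M b T := by
        refine ⟨hmem.1, hmem.2.1, fun k hk => ?_⟩
        have hki : k ≠ i := by
          rintro rfl
          simp [hT, hneg.not_ge] at hk
        simp [hpT.2.2 k hk, hEk i k (hpT.2.2 k hk) hki]
      rw [hTp, Set.mem_singleton_iff] at hmemT
      have := congrFun hmemT i
      simp only [Pi.add_apply, Pi.smul_apply, hEi i hpi, smul_eq_mul, mul_one] at this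
      linarith
    have h := hv (u - p) (by rw [Matrix.mulVec_sub, hu.1, hpP.1, sub_self])
    have h' : 0 ≤ ∑ i, (u - p) i * (v ⬝ᵥ E i) := by
      refine Finset.sum_nonneg fun i _ => ?_
      by_cases hi : p i = 0
      · exact mul_nonneg (by simpa [hi] using hu.2.1 i) (hpos i)
      · simp [hE0 i hi]
    rw [dotProduct_sub] at h
    linarith

/-! ### The star-collapse induced by a generic functional -/

/-- A functional that is nonconstant on faces of positive dimension has at most one maximizer on
each face. -/
lemma IsFace.eq_of_isMax {F : Set (Fin n → ℝ)}
    (hnc : ∀ F ∈ faces (coordFace M b ∅), (∀ x ∈ F, ∀ y ∈ F, v ⬝ᵥ x = v ⬝ᵥ y) →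
      F.Subsingleton)
    (hF : IsFace (coordFace M b ∅) F) {x y : Fin n → ℝ} (hx : x ∈ F) (hy : y ∈ F)
    (hxm : ∀ z ∈ F, v ⬝ᵥ z ≤ v ⬝ᵥ x) (hxy : v ⬝ᵥ x ≤ v ⬝ᵥ y) : y = x := by
  have hface : IsFace F {y ∈ F | ∀ z ∈ F, dotCLM v z ≤ dotCLM v y} :=
    isFace_argmax (dotCLM v) hx (by simpa using hxm)
  simp only [dotCLM_apply] at hface
  exact hnc _ (hF.trans_coordFace hface)
    (fun u hu w hw => (hw.2 u hu.1).antisymm (hu.2 w hw.1))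
    ⟨hy, fun z hz => (hxm z hz).trans hxy⟩ ⟨hx, hxm⟩

lemma exists_vertex_isMax {F : Set (Fin n → ℝ)}
    (hnc : ∀ F ∈ faces (coordFace M b ∅), (∀ x ∈ F, ∀ y ∈ F, v ⬝ᵥ x = v ⬝ᵥ y) →
      F.Subsingleton)
    (hF : F ∈ boundedComplex (coordFace M b ∅)) :
    ∃ p ∈ F, IsFace (coordFace M b ∅) {p} ∧ ∀ x ∈ F, v ⬝ᵥ x ≤ v ⬝ᵥ p := by
  obtain ⟨hF, hbd⟩ := hF
  have hcl : IsClosed F := by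
    obtain ⟨S, -, rfl⟩ := hF.exists_eq_coordFace
    exact isClosed_coordFace
  obtain ⟨p, hp, hmax⟩ := (Metric.isCompact_of_isClosed_isBounded hcl hbd).exists_isMaxOn hF.1
    (f := fun x => v ⬝ᵥ x) (Continuous.continuousOn (by fun_prop))
  replace hmax : ∀ x ∈ F, v ⬝ᵥ x ≤ v ⬝ᵥ p := hmax
  refine ⟨p, hp, ?_, hmax⟩
  have hface := isFace_argmax (dotCLM v) hp (by simpa using hmax)
  simp only [dotCLM_apply] at hface
  convert hF.trans_coordFace hface using 1
  ext y
  rw [Set.mem_singleton_iff]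
  constructor
  · rintro rfl
    exact ⟨hp, hmax⟩
  · exact fun hy => hF.eq_of_isMax hnc hp hy.1 hmax (hy.2 p hp)

/-- A functional that is nonconstant on faces of positive dimension has at most one minimizer on
the polyhedron. -/
lemma eq_of_isMin
    (hnc : ∀ F ∈ faces (coordFace M b ∅), (∀ x ∈ F, ∀ y ∈ F, v ⬝ᵥ x = v ⬝ᵥ y) →
      F.Subsingleton)
    {x y : Fin n → ℝ} (hx : x ∈ coordFace M b ∅) (hy : y ∈ coordFace M b ∅)
    (hxm : ∀ z ∈ coordFace M b ∅, v ⬝ᵥ x ≤ v ⬝ᵥ z) (hxy : v ⬝ᵥ y ≤ v ⬝ᵥ x) : y = x := by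
  refine IsFace.eq_of_isMax (v := -v) (F := coordFace M b ∅)
    (fun F hF hc => hnc F hF fun x hx y hy => ?_)
    (isFace_coordFace (Finset.empty_subset _) ⟨x, hx⟩) hx hy ?_ ?_
  · simpa [neg_dotProduct] using hc x hx y hy
  · simpa [neg_dotProduct] using hxm
  · simpa [neg_dotProduct] using hxy

/-- The largest faces on which `v` is maximal at the vertices form a star-collapse. Apart from
positive dimension, guaranteed by `hmin`, this only uses that `v` has a unique maximizer on each
bounded face. -/
lemma isStarCollapse_of_isGreatest
    (hnc : ∀ F ∈ faces (coordFace M b ∅), (∀ x ∈ F, ∀ y ∈ F, v ⬝ᵥ x = v ⬝ᵥ y) →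
      F.Subsingleton)
    {r : ℕ} {p : Fin (r + 1) → Fin n → ℝ} (hp : IsVertexOrder (coordFace M b ∅) v p)
    {P : Fin (r + 1) → Set (Fin n → ℝ)}
    (hP : ∀ j, IsGreatest {F | F ∈ boundedComplex (coordFace M b ∅) ∧ p j ∈ F ∧
        ∀ x ∈ F, v ⬝ᵥ x ≤ v ⬝ᵥ p j} (P j))
    (hmin : ∀ j, P j = {p j} → ∀ u ∈ coordFace M b ∅, v ⬝ᵥ p j ≤ v ⬝ᵥ u) :
    IsStarCollapse (boundedComplex (coordFace M b ∅)) P p := by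
  have hvert : ∀ j, IsFace (coordFace M b ∅) {p j} := fun j => by
    have : p j ∈ {x | IsFace (coordFace M b ∅) {x}} := hp.range_eq ▸ Set.mem_range_self j
    exact this
  have hface : ∀ j, IsFace (coordFace M b ∅) (P j) := fun j => (hP j).1.1.1
  -- every bounded face has a maximal vertex `p k` and is then a face of `P k`
  have hexists : ∀ F ∈ boundedComplex (coordFace M b ∅),
      ∃ k, p k ∈ F ∧ F ∈ faces (P k) := by
    intro F hF
    obtain ⟨q, hqF, hq, hmax⟩ := exists_vertex_isMax hnc hF
    obtain ⟨k, rfl⟩ : q ∈ Set.range p := hp.range_eq ▸ hq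
    exact ⟨k, hqF, hF.1.of_subset (hface k) ((hP k).2 ⟨hF, hqF, hmax⟩)⟩
  have hbdd : ∀ j, ∀ F ∈ faces (P j), F ∈ boundedComplex (coordFace M b ∅) := fun j F hF =>
    ⟨(hface j).trans_coordFace hF, (hP j).1.1.2.subset hF.2.subset⟩
  -- a vertex in `P i` other than `p i` comes earlier than `p i`
  have hlt : ∀ i k, p k ∈ P i → k ≤ i := by
    intro i k hk
    rcases lt_or_ge (v ⬝ᵥ p k) (v ⬝ᵥ p i) with h | h
    · exact (hp.order k i h).le
    · exact (hp.injective ((hface i).eq_of_isMax hnc (hP i).1.2.1 hk (hP i).1.2.2 h)).le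
  refine ⟨fun j => (hP j).1.1, fun j => ?_, ?_, fun j => ?_, fun j hj hPj => ?_⟩
  · exact (hvert j).of_subset (hface j) (Set.singleton_subset_iff.2 (hP j).1.2.1)
  · ext F
    constructor
    · rintro ⟨i, -, hF⟩
      exact hbdd i F hF
    · intro hF
      obtain ⟨k, -, hk⟩ := hexists F hF
      exact ⟨k, Fin.le_last k, hk⟩
  · ext F
    constructor
    · rintro ⟨⟨i, hij, hF⟩, hnot⟩
      obtain rfl : i = j := by
        by_contra h
        exact hnot ⟨i, lt_of_le_of_ne hij h, hF⟩
      obtain ⟨k, hkF, hk⟩ := hexists F (hbdd i F hF)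
      rcases (hlt i k (hF.2.subset hkF)).lt_or_eq with h | rfl
      · exact absurd ⟨k, h, hk⟩ hnot
      · exact ⟨hF, hkF⟩
    · rintro ⟨hF, hpF⟩
      refine ⟨⟨j, le_rfl, hF⟩, ?_⟩
      rintro ⟨i, hij, hFi⟩
      exact (hlt i j (hFi.2.subset hpF)).not_gt hij
  · have hmem : ∀ k, p k ∈ coordFace M b ∅ := fun k => (hvert k).2.subset rfl
    refine hj.ne (hp.injective (eq_of_isMin hnc (hmem j) (hmem 0) (hmin j hPj) ?_))
    by_contra! h
    exact absurd (hp.order j 0 h) (Fin.not_lt_zero j)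

/-! ### Existence of a generic functional -/

/-- Finitely many nonzero vectors admit a positive vector that is orthogonal to none of them: a
point `(1, t, t², …)` of the moment curve works for all but finitely many `t > 0`. -/
lemma exists_pos_dotProduct_ne_zero {Z : Set (Fin n → ℝ)} (hZ : Z.Finite) (h0 : 0 ∉ Z) :
    ∃ v : Fin n → ℝ, (∀ i, 0 < v i) ∧ ∀ z ∈ Z, v ⬝ᵥ z ≠ 0 := by
  let q : (Fin n → ℝ) → Polynomial ℝ := fun z => ∑ i, Polynomial.monomial i.1 (z i)
  have hq : ∀ z ∈ Z, q z ≠ 0 := by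
    intro z hz hqz
    refine h0 ?_
    convert hz
    ext i
    have : (q z).coeff i = z i := by
      simp [q, Polynomial.finsetSum_coeff, Polynomial.coeff_monomial, Fin.val_inj]
    rw [← this, hqz]
    simp
  have hfin : (⋃ z ∈ Z, {t : ℝ | (q z).IsRoot t}).Finite :=
    hZ.biUnion fun z hz => Polynomial.finite_setOfPred_isRoot (hq z hz)
  obtain ⟨t, ht, hroot⟩ := (Set.Ioi_infinite (0 : ℝ)).exists_notMem_finite hfin
  refine ⟨fun i => t ^ i.1, fun i => pow_pos ht _, fun z hz h => hroot ?_⟩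
  simp only [Set.mem_iUnion]
  refine ⟨z, hz, ?_⟩
  show (q z).eval t = 0
  rw [← h]
  simp [q, Polynomial.eval_finsetSum, dotProduct, mul_comm]

lemma exists_pos_nonconstant_on_faces (M : Matrix (Fin d) (Fin n) ℝ) (b : Fin d → ℝ) :
    ∃ v : Fin n → ℝ, (∀ i, 0 < v i) ∧
      ∀ F ∈ faces (coordFace M b ∅), (∀ x ∈ F, ∀ y ∈ F, v ⬝ᵥ x = v ⬝ᵥ y) →
        F.Subsingleton := by
  have hpair : ∀ F : Set (Fin n → ℝ), ∃ z : Fin n → ℝ,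
      ¬ F.Subsingleton → z ≠ 0 ∧ ∃ x ∈ F, ∃ y ∈ F, z = x - y := by
    intro F
    by_cases hF : F.Subsingleton
    · exact ⟨0, fun h => absurd hF h⟩
    · obtain ⟨x, hx, y, hy, hne⟩ := Set.not_subsingleton_iff.1 hF
      exact ⟨x - y, fun _ => ⟨sub_ne_zero.2 hne, x, hx, y, hy, rfl⟩⟩
  choose z hz using hpair
  obtain ⟨v, hpos, hv⟩ := exists_pos_dotProduct_ne_zero
    (Z := z '' {F ∈ faces (coordFace M b ∅) | ¬ F.Subsingleton})
    ((finite_faces_coordFace.subset (Set.sep_subset _ _)).image _)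
    (by rintro ⟨F, hF, h⟩; exact (hz F hF.2).1 h)
  refine ⟨v, hpos, fun F hF hc => ?_⟩
  by_contra hns
  obtain ⟨-, x, hx, y, hy, hxy⟩ := hz F hns
  refine hv _ ⟨F, ⟨hF, hns⟩, rfl⟩ ?_
  rw [hxy, dotProduct_sub, hc x hx y hy, sub_self]

lemma exists_isVertexOrder {P : Set (Fin n → ℝ)} (hfin : {x | IsFace P {x}}.Finite)
    (hne : {x | IsFace P {x}}.Nonempty) (v : Fin n → ℝ) :
    ∃ (r : ℕ) (p : Fin (r + 1) → Fin n → ℝ), IsVertexOrder P v p := by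
  have := hfin.to_subtype
  have := hne.to_subtype
  obtain ⟨m, ⟨e⟩⟩ := Finite.exists_equiv_fin {x | IsFace P {x}}
  obtain ⟨r, rfl⟩ : ∃ r, m = r + 1 := by
    refine Nat.exists_eq_succ_of_ne_zero ?_
    rintro rfl
    exact (e (Classical.arbitrary _)).elim0
  let f : Fin (r + 1) → ℝ := fun i => v ⬝ᵥ (e.symm i).1
  let s : Fin (r + 1) ≃ {x | IsFace P {x}} := (Tuple.sort f).trans e.symm
  refine ⟨r, fun i => (s i).1, Subtype.val_injective.comp s.injective, ?_, fun i j hij => ?_⟩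
  · exact (s.surjective.range_comp Subtype.val).trans Subtype.range_val
  · exact (Tuple.monotone_sort f).reflect_lt hij

end ToricHyper

/-- The bounded complex of `P_θ` is star-collapsible; more precisely, for every generic functional
`v` and every compatible order `p` of the vertices, the largest bounded faces `P j` on which `v` is
maximal at `p j` form a star-collapse. In particular the bounded complex is contractible. -/
theorem mainTheorem9 (d n : ℕ) (A : Matrix (Fin d) (Fin n) ℤ) (hA : ToricHyper.CoprimeMinors A)
    (θ : Fin d → ℤ) (hθ : ToricHyper.IsGeneric A θ) :
    ToricHyper.IsStarCollapsible (ToricHyper.boundedComplex (ToricHyper.polyhedron A θ)) ∧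
    (∀ v : Fin n → ℝ, ToricHyper.IsGenericFunctional A θ v →
      ∀ (r : ℕ) (p : Fin (r + 1) → Fin n → ℝ),
        ToricHyper.IsVertexOrder (ToricHyper.polyhedron A θ) v p →
        ∃ P : Fin (r + 1) → Set (Fin n → ℝ),
          (∀ j, IsGreatest {F | F ∈ ToricHyper.boundedComplex (ToricHyper.polyhedron A θ) ∧
            p j ∈ F ∧ ∀ x ∈ F, v ⬝ᵥ x ≤ v ⬝ᵥ p j} (P j)) ∧
          ToricHyper.IsStarCollapse
            (ToricHyper.boundedComplex (ToricHyper.polyhedron A θ)) P p) ∧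
    ContractibleSpace
      (ToricHyper.support (ToricHyper.boundedComplex (ToricHyper.polyhedron A θ))) := by
  obtain ⟨M, hM⟩ : ∃ M : Matrix (Fin d) (Fin n) ℝ, M = A.map (Int.cast : ℤ → ℝ) := ⟨_, rfl⟩
  obtain ⟨b, hb⟩ : ∃ b : Fin d → ℝ, b = fun i => (θ i : ℝ) := ⟨_, rfl⟩
  have hpoly : ToricHyper.polyhedron A θ = ToricHyper.coordFace M b ∅ := by
    ext u
    simp [ToricHyper.polyhedron, ToricHyper.coordFace, hM, hb]
  have hgen : ∀ S : Finset (Fin n), S.card < d → ∀ u ∈ ToricHyper.coordFace M b ∅,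
      ∃ i, i ∉ S ∧ u i ≠ 0 := by
    intro S hS u hu
    by_contra! h
    exact hθ.2 S hS ⟨u, hu.2.1, h, by rw [← hM, ← hb]; exact hu.1⟩
  have hne : (ToricHyper.coordFace M b ∅).Nonempty := by
    obtain ⟨u, hu⟩ := hθ.1
    refine ⟨fun i => (u i : ℝ), ?_, fun i => Nat.cast_nonneg _, by simp⟩
    rw [hM, hb, ← hu]
    ext i
    simp [Matrix.mulVec, dotProduct]
  have hcontr := ToricHyper.contractibleSpace_support_boundedComplex hne
  have hmain : ∀ v : Fin n → ℝ, ToricHyper.IsGenericFunctional A θ v →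
      ∀ (r : ℕ) (p : Fin (r + 1) → Fin n → ℝ),
        ToricHyper.IsVertexOrder (ToricHyper.polyhedron A θ) v p →
        ∃ P : Fin (r + 1) → Set (Fin n → ℝ),
          (∀ j, IsGreatest {F | F ∈ ToricHyper.boundedComplex (ToricHyper.polyhedron A θ) ∧
            p j ∈ F ∧ ∀ x ∈ F, v ⬝ᵥ x ≤ v ⬝ᵥ p j} (P j)) ∧
          ToricHyper.IsStarCollapse
            (ToricHyper.boundedComplex (ToricHyper.polyhedron A θ)) P p := by
    intro v hv r p hp
    have hint := hv.interior
    have hnc := hv.nonconstant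
    rw [← hM] at hint
    rw [hpoly] at hnc hp ⊢
    have hvert : ∀ j, ToricHyper.IsFace (ToricHyper.coordFace M b ∅) {p j} := fun j => by
      have : p j ∈ {x | ToricHyper.IsFace (ToricHyper.coordFace M b ∅) {x}} :=
        hp.range_eq ▸ Set.mem_range_self j
      exact this
    choose P hP hmin using fun j =>
      ToricHyper.exists_largest_boundedFace hgen hint hnc (hvert j)
    exact ⟨P, hP, ToricHyper.isStarCollapse_of_isGreatest hnc hp hP hmin⟩
  refine ⟨?_, hmain, hpoly ▸ hcontr⟩
  obtain ⟨v, hpos, hnc⟩ := ToricHyper.exists_pos_nonconstant_on_faces M b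
  have hv : ToricHyper.IsGenericFunctional A θ v := by
    refine ⟨fun x _ hx hx0 => ?_, hpoly ▸ hnc⟩
    obtain ⟨i, hi⟩ := Function.ne_iff.1 hx0
    exact Finset.sum_pos' (fun k _ => mul_nonneg (hpos k).le (hx k))
      ⟨i, Finset.mem_univ i, mul_pos (hpos i) ((hx i).lt_of_ne hi.symm)⟩
  -- the support is nonempty, so there is a bounded face, and it has a vertex
  obtain ⟨⟨x, F, hF, -⟩⟩ : Nonempty
      (ToricHyper.support (ToricHyper.boundedComplex (ToricHyper.coordFace M b ∅))) :=
    inferInstance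
  obtain ⟨q, -, hq, -⟩ := ToricHyper.exists_vertex_isMax hnc hF
  have hfin : {x | ToricHyper.IsFace (ToricHyper.polyhedron A θ) {x}}.Finite := by
    rw [hpoly]
    exact ToricHyper.finite_faces_coordFace.preimage Set.singleton_injective.injOn
  obtain ⟨r, p, hp⟩ := ToricHyper.exists_isVertexOrder hfin ⟨q, hpoly ▸ hq⟩ v
  obtain ⟨P, -, hcollapse⟩ := hmain v hv r p hp
  exact ⟨r, P, p, hcollapse⟩
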